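/- Let $q$ be a prime power and $n\ge 1$ an integer with $\gcd(q,n)=1$. For a polynomial $g=\sum_i a_i x^i\in\mathbb F_{q^2}[x]$ put $\overline g:=\sum_i a_i^q x^i$, for $g(0)\ne 0$ put $g^*(x):=g(0)^{-1}x^{\deg g}g(x^{-1})$, and let $g^\dagger:=\overline{g^*}$. Let $$x^n-1=\prod_{j\in J_0}f_j\prod_{j\in J_1}f_j\overline{f_j}\prod_{j\in J_2\cup J_3}f_jf_j^*\prod_{j\in J_4}f_jf_j^*\overline{f_j}f_j^\dagger$$ be a factorisation of $x^n-1$ into monic irreducible polynomials of $\mathbb F_{q^2}[x]$, where the finite index set $J=J_0\cup J_1\cup J_2\cup J_3\cup J_4$ is partitioned as follows: $j\in J_0$ iff $f_j=\overline{f_j}=f_j^*$; $j\in J_1$ iff $f_j=f_j^*\neq\overline{f_j}$; $j\in J_2$ iff $f_j=\overline{f_j}\ne f_j^*$; $j\in J_3$ iff $\overline{f_j}=f_j^*\neq f_j$; $j\in J_4$ iff $f_j,\overline{f_j},f_j^*$ are pairwise different. For each $j\in J$ let $\alpha_j$ be a root of $f_j$ in a fixed extension field of $\mathbb F_{q^2}$.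 Let $D_n=\langle a,b\mid a^n=b^2=1,\ bab=a^{-1}\rangle$ be the dihedral group of order $2n$, and let $C_2$ be the cyclic group of order $2$ generated by the matrix $\begin{bmatrix}0&1\\1&0\end{bmatrix}$. For $j\in J_1$ put $$Z_j:=\begin{bmatrix}1&-\alpha_j\\1&-\alpha_j^{-1}\end{bmatrix},\quad \overline{Z_j}:=\begin{bmatrix}1&-\alpha_j^q\\1&-\alpha_j^{-q}\end{bmatrix},\quad \sigma_j(X):=Z_j^{-1}XZ_j,\quad \overline{\sigma_j}(X):=\overline{Z_j}^{\,-1}X\overline{Z_j}.$$ Then there exists an isomorphism of $\mathbb F_{q^2}$-algebras $\rho=\bigoplus_{j\in J}\rho_j:\mathbb F_{q^2}[D_n]\to\bigoplus_{j\in J}A_j$, where $$A_j=\begin{cases}\mathbb F_{q^2}\oplus\mathbb F_{q^2}& j\in J_0,\ \mathrm{char}(\mathbb F_{q^2})\ne2,\\ \mathbb F_{q^2}[C_2]& j\in J_0,\ \mathrm{char}(\mathbb F_{q^2})=2,\\ \mathcal M_2(\mathbb F_{q^2}(\alpha_j+\alpha_j^{-1}))\oplus\mathcal M_2(\mathbb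 F_{q^2}(\alpha_j^q+\alpha_j^{-q}))& j\in J_1,\\ \mathcal M_2(\mathbb F_{q^2}(\alpha_j))& j\in J_2\cup J_3,\\ \mathcal M_2(\mathbb F_{q^2}(\alpha_j))\oplus\mathcal M_2(\mathbb F_{q^2}(\alpha_j^q))& j\in J_4,\end{cases}$$ and the images of the generators are as follows. i) For $j\in J_0$ and $\mathrm{char}(\mathbb F_{q^2})\neq2$: $f_j\in\{x-1,x+1\}$; if $f_j=x-1$, then $\rho_j(a)=(1,1)$ and $\rho_j(b)=(1,-1)$; if $f_j=x+1$, then $\rho_j(a)=(-1,-1)$ and $\rho_j(b)=(1,-1)$. For $j\in J_0$ and $\mathrm{char}(\mathbb F_{q^2})=2$: $\rho_j(a)=\begin{bmatrix}1&0\\0&1\end{bmatrix}$ and $\rho_j(b)=\begin{bmatrix}0&1\\1&0\end{bmatrix}$, as elements of $C_2\subset\mathbb F_{q^2}[C_2]$. ii) For $j\in J_1$: $$\rho_j(a)=\sigma_j\left(\begin{bmatrix}\alpha_j&0\\0&\alpha_j^{-1}\end{bmatrix}\right)\oplus\overline{\sigma_j}\left(\begin{bmatrix}\alpha_j^q&0\\0&\alpha_j^{-q}\end{bmatrix}\right),\qquad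 \rho_j(b)=\sigma_j\left(\begin{bmatrix}0&1\\1&0\end{bmatrix}\right)\oplus\overline{\sigma_j}\left(\begin{bmatrix}0&1\\1&0\end{bmatrix}\right).$$ iii) For $j\in J_2\cup J_3$: $$\rho_j(a)=\begin{bmatrix}\alpha_j&0\\0&\alpha_j^{-1}\end{bmatrix},\qquad\rho_j(b)=\begin{bmatrix}0&1\\1&0\end{bmatrix}.$$ iv) For $j\in J_4$: $$\rho_j(a)=\begin{bmatrix}\alpha_j&0\\0&\alpha_j^{-1}\end{bmatrix}\oplus\begin{bmatrix}\alpha_j^q&0\\0&\alpha_j^{-q}\end{bmatrix},\qquad\rho_j(b)=\begin{bmatrix}0&1\\1&0\end{bmatrix}\oplus\begin{bmatrix}0&1\\1&0\end{bmatrix}.$$ -/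

import Mathlib

open Polynomial

namespace HermitianDihedral

section Polynomials

variable {F : Type*} [Field F]

/-- The reciprocal polynomial `g* = g(0)⁻¹ x^{deg g} g(x⁻¹)`. -/
noncomputable def recip (g : F[X]) : F[X] := C (g.coeff 0)⁻¹ * g.reverse

/-- The conjugate polynomial `∑ aᵢ^q xⁱ` of `g = ∑ aᵢ xⁱ`. -/
noncomputable def conj (q : ℕ) (g : F[X]) : F[X] := g.sum fun i a => monomial i (a ^ q)

/-- `g† = conjugate of the reciprocal of g`. -/
noncomputable def dagger (q : ℕ) (g : F[X]) : F[X] := conj q (recip g)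

variable {J : Type*} [Fintype J]

open Classical in
/-- Indices with `f_j = conj f_j = f_j*`. -/
noncomputable def J₀ (q : ℕ) (f : J → F[X]) : Finset J :=
  Finset.univ.filter fun j => f j = conj q (f j) ∧ f j = recip (f j)

open Classical in
/-- Indices with `f_j = f_j*` and `f_j ≠ conj f_j`. -/
noncomputable def J₁ (q : ℕ) (f : J → F[X]) : Finset J :=
  Finset.univ.filter fun j => f j = recip (f j) ∧ f j ≠ conj q (f j)

open Classical in
/-- Indices with `f_j = conj f_j` and `f_j ≠ f_j*`. -/
noncomputable def J₂ (q : ℕ) (f : J → F[X]) : Finset J :=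
  Finset.univ.filter fun j => f j = conj q (f j) ∧ f j ≠ recip (f j)

open Classical in
/-- Indices with `conj f_j = f_j*` and `f_j ≠ f_j*`. -/
noncomputable def J₃ (q : ℕ) (f : J → F[X]) : Finset J :=
  Finset.univ.filter fun j => conj q (f j) = recip (f j) ∧ f j ≠ recip (f j)

open Classical in
/-- Indices with `f_j`, `conj f_j`, `f_j*` pairwise different. -/
noncomputable def J₄ (q : ℕ) (f : J → F[X]) : Finset J :=
  Finset.univ.filter fun j =>
    f j ≠ conj q (f j) ∧ f j ≠ recip (f j) ∧ conj q (f j) ≠ recip (f j)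

/-- The family `f` gives the factorisation of `x^n - 1` into monic irreducible polynomials,
one `f_j` being chosen from each orbit under reciprocation and conjugation. -/
structure IsRefinedFactorisation (q n : ℕ) (f : J → F[X]) : Prop where
  monic : ∀ j, (f j).Monic
  irreducible : ∀ j, Irreducible (f j)
  prod_eq : (X : F[X]) ^ n - 1 =
    (∏ j ∈ J₀ q f, f j) *
    (∏ j ∈ J₁ q f, f j * conj q (f j)) *
    ((∏ j ∈ J₂ q f, f j * recip (f j)) * ∏ j ∈ J₃ q f, f j * recip (f j)) *
    ∏ j ∈ J₄ q f, f j * recip (f j) * conj q (f j) * dagger q (f j)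

end Polynomials

/-- The matrix with rows `(0, 1)` and `(1, 0)`, as an element of `GL₂(F)`. -/
def swapGL (F : Type*) [Field F] : GL (Fin 2) F where
  val := !![0, 1; 1, 0]
  inv := !![0, 1; 1, 0]
  val_inv := by simp [Matrix.one_fin_two]
  inv_val := by simp [Matrix.one_fin_two]

/-- The cyclic group of order two generated by the matrix with rows `(0, 1)` and `(1, 0)`. -/
abbrev C₂ (F : Type*) [Field F] : Subgroup (GL (Fin 2) F) := Subgroup.zpowers (swapGL F)

/-- The generator of `C₂`. -/
def C₂gen (F : Type*) [Field F] : C₂ F := ⟨swapGL F, Subgroup.mem_zpowers _⟩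

section Blocks

variable {F : Type*} [Field F] {L : Type*} [Field L] [Algebra F L]

/-- The matrix with rows `(1, -β)` and `(1, -β⁻¹)`. -/
def Z (β : L) : Matrix (Fin 2) (Fin 2) L := !![1, -β; 1, -β⁻¹]

/-- Conjugation `M ↦ Z⁻¹ M Z` by the matrix `Z = Z β`. -/
noncomputable def sigma (β : L) (M : Matrix (Fin 2) (Fin 2) L) : Matrix (Fin 2) (Fin 2) L :=
  (Z β)⁻¹ * M * Z β

/-- The matrix `diag(β, β⁻¹)`. -/
def diagInv (β : L) : Matrix (Fin 2) (Fin 2) L := !![β, 0; 0, β⁻¹]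

/-- The matrix with rows `(0, 1)` and `(1, 0)`. -/
def swap (L : Type*) [Field L] : Matrix (Fin 2) (Fin 2) L := !![0, 1; 1, 0]

/-- The matrix algebra `M₂(F(β))`, where `β` lies in the extension `L` of `F`. -/
abbrev M₂ (F : Type*) [Field F] {L : Type*} [Field L] [Algebra F L] (β : L) : Type _ :=
  Matrix (Fin 2) (Fin 2) (IntermediateField.adjoin F {β})

/-- The inclusion of `M₂(F(β))` in `M₂(L)`. -/
def M₂.incl {β : L} (M : M₂ F β) : Matrix (Fin 2) (Fin 2) L := M.map Subtype.val

variable {J : Type*} [Fintype J]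

/-- The direct sum of the blocks `A_j` for `j ∉ J₀`:
`M₂(F(α_j + α_j⁻¹)) ⊕ M₂(F(α_j^q + α_j^{-q}))` for `j ∈ J₁`, `M₂(F(α_j))` for `j ∈ J₂ ∪ J₃`,
and `M₂(F(α_j)) ⊕ M₂(F(α_j^q))` for `j ∈ J₄`. -/
abbrev MatrixBlocks (q : ℕ) (f : J → F[X]) (α : J → L) : Type _ :=
  ((j : {j // j ∈ J₁ q f}) →
    M₂ F (α j + (α j)⁻¹) × M₂ F ((α j) ^ q + ((α j) ^ q)⁻¹)) ×
  ((j : {j // j ∈ J₂ q f ∨ j ∈ J₃ q f}) → M₂ F (α j)) ×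
  ((j : {j // j ∈ J₄ q f}) → M₂ F (α j) × M₂ F ((α j) ^ q))

/-- The pair `(A, B)` has the components prescribed for the images of the generators `a` and `b`
in the blocks `A_j`, `j ∉ J₀`; the components are compared after inclusion in `M₂(L)`. -/
structure IsGeneratorImage (q : ℕ) (f : J → F[X]) (α : J → L) (A B : MatrixBlocks q f α) :
    Prop where
  a_J₁ : ∀ j, (A.1 j).1.incl = sigma (α j) (diagInv (α j)) ∧
    (A.1 j).2.incl = sigma ((α j) ^ q) (diagInv ((α j) ^ q))
  b_J₁ : ∀ j, (B.1 j).1.incl = sigma (α j) (swap L) ∧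
    (B.1 j).2.incl = sigma ((α j) ^ q) (swap L)
  a_J₂₃ : ∀ j, (A.2.1 j).incl = diagInv (α j)
  b_J₂₃ : ∀ j, (B.2.1 j).incl = swap L
  a_J₄ : ∀ j, (A.2.2 j).1.incl = diagInv (α j) ∧ (A.2.2 j).2.incl = diagInv ((α j) ^ q)
  b_J₄ : ∀ j, (B.2.2 j).1.incl = swap L ∧ (B.2.2 j).2.incl = swap L

end Blocks

/-- The rotation `a` of order `n`, in the group algebra `F[D_n]`. -/
noncomputable def genA (F : Type*) [Field F] (n : ℕ) : MonoidAlgebra F (DihedralGroup n) :=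
  MonoidAlgebra.of F _ (DihedralGroup.r 1)

/-- The reflection `b`, with `b² = 1` and `b a b = a⁻¹`, in the group algebra `F[D_n]`. -/
noncomputable def genB (F : Type*) [Field F] (n : ℕ) : MonoidAlgebra F (DihedralGroup n) :=
  MonoidAlgebra.of F _ (DihedralGroup.sr 0)

end HermitianDihedral

/-! Moving `b` to the left writes every element of the group algebra as `p(a) + b r(a)` with `p`,
`r` of degree less than `n`. The prescribed matrices satisfy the dihedral relations because each `α
j` is an `n`-th root of unity, so they define an algebra homomorphism. It is bijective once it is
injective and its target has dimension at most `2 * n` (`exists_algEquiv_of_relations`);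
surjectivity is never checked directly.

Injectivity: for `A = diag(β, β⁻¹)` and `B` the swap, the four entries of `p(A) + B r(A)` are the
values of `p` and `r` at `β` and `β⁻¹`. Hence for a kernel element all irreducible factors of `X ^ n
- 1` divide both `p` and `r`. As `q` is coprime to `n`, `X ^ n - 1` is squarefree, so it divides `p`
and `r`, which vanish for degree reasons (`IsRefinedFactorisation.dvd_of_forall`).

Dimension: each block has at most twice the degree of the factor of `X ^ n - 1` belonging to `j`.
Only `J₁` needs an argument. Conjugation by `Z β` moves the entries into `F(β + β⁻¹)`, and a power
of Frobenius inverting `β` fixes `β + β⁻¹`, so this field has at most half the degree of `F(β)`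
(`two_mul_finrank_adjoin_add_inv_le`).

For `J₀`, a parity argument on Frobenius exponents gives `β⁻¹ = β`, so the factor is `X - 1` or `X +
1` (`inv_eq_self_of_conj_eq_of_recip_eq`). -/

namespace HermitianDihedral

/-! ### Conjugate and reciprocal polynomials and their roots -/

section ConjRecip

variable {F : Type*} [Field F] {L : Type*} [Field L] [Algebra F L]

theorem conj_eq_map {q : ℕ} (φ : F →+* F) (hφ : ∀ x, φ x = x ^ q) (g : F[X]) :
    conj q g = g.map φ := by
  simp only [conj, Polynomial.map, eval₂_eq_sum, RingHom.comp_apply, hφ, C_mul_X_pow_eq_monomial]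

theorem monic_conj {q : ℕ} (φ : F →+* F) (hφ : ∀ x, φ x = x ^ q) {g : F[X]} (hg : g.Monic) :
    (conj q g).Monic := by
  rw [conj_eq_map φ hφ]
  exact hg.map φ

theorem natDegree_conj {q : ℕ} (φ : F →+* F) (hφ : ∀ x, φ x = x ^ q) (g : F[X]) :
    (conj q g).natDegree = g.natDegree := by
  rw [conj_eq_map φ hφ, natDegree_map]

theorem irreducible_conj {q : ℕ} (φ : F ≃+* F) (hφ : ∀ x, φ x = x ^ q) {g : F[X]}
    (hg : Irreducible g) : Irreducible (conj q g) := by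
  rw [conj_eq_map φ.toRingHom hφ]
  exact (MulEquiv.irreducible_iff (Polynomial.mapEquiv φ)).2 hg

theorem aeval_conj {q : ℕ} (φ : F →+* F) (hφ : ∀ x, φ x = x ^ q) (ψ : L →+* L)
    (hψ : ∀ x, ψ x = x ^ q) (g : F[X]) (β : L) :
    aeval (β ^ q) (conj q g) = (aeval β g) ^ q := by
  rw [conj_eq_map φ hφ, aeval_def, eval₂_map, ← hψ, ← hψ, aeval_def, hom_eval₂]
  congr 1
  ext x
  simp [hφ, hψ]

theorem monic_recip {g : F[X]} (hg : g.coeff 0 ≠ 0) : (recip g).Monic := by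
  rw [Monic, recip, leadingCoeff_mul, leadingCoeff_C, reverse_leadingCoeff, trailingCoeff,
    natTrailingDegree_eq_zero.2 (Or.inr hg), inv_mul_cancel₀ hg]

theorem natDegree_recip {g : F[X]} (hg : g.coeff 0 ≠ 0) :
    (recip g).natDegree = g.natDegree := by
  rw [recip, natDegree_C_mul (inv_ne_zero hg), reverse_natDegree,
    natTrailingDegree_eq_zero.2 (Or.inr hg), tsub_zero]

theorem aeval_inv_recip {g : F[X]} {β : L} (hβ : β ≠ 0) (h : aeval β g = 0) :
    aeval β⁻¹ (recip g) = 0 := by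
  let _ := invertibleOfNonzero hβ
  have := (eval₂_reverse_eq_zero_iff (algebraMap F L) β g).2 h
  rw [invOf_eq_inv] at this
  rw [recip, map_mul, aeval_def β⁻¹ g.reverse, this, mul_zero]

theorem dvd_of_aeval_eq_zero {g p : F[X]} (hg : Irreducible g) (hm : g.Monic) {β : L}
    (h : aeval β g = 0) (hp : aeval β p = 0) : g ∣ p := by
  rw [minpoly.eq_of_irreducible_of_monic hg h hm]
  exact minpoly.dvd F β hp

theorem finrank_adjoin_of_irreducible {g : F[X]} (hg : Irreducible g) (hm : g.Monic) {β : L}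
    (h : aeval β g = 0) :
    Module.finrank F (IntermediateField.adjoin F {β}) = g.natDegree := by
  rw [IntermediateField.adjoin.finrank ⟨g, hm, h⟩, ← minpoly.eq_of_irreducible_of_monic hg h hm]

theorem adjoin_inv (β : L) :
    IntermediateField.adjoin F {β⁻¹} = IntermediateField.adjoin F {β} := by
  apply le_antisymm <;> rw [IntermediateField.adjoin_simple_le_iff]
  · exact inv_mem (IntermediateField.mem_adjoin_simple_self F β)
  · simpa using inv_mem (IntermediateField.mem_adjoin_simple_self F β⁻¹)

theorem coeff_zero_ne_zero {g : F[X]} (hg : Irreducible g) {β : L} (hβ : β ≠ 0)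
    (h : aeval β g = 0) : g.coeff 0 ≠ 0 := by
  intro h0
  obtain ⟨r, hr⟩ := X_dvd_iff.2 h0
  rcases hg.isUnit_or_isUnit hr with hu | hu
  · exact not_isUnit_X hu
  · rw [hr, map_mul, aeval_X] at h
    exact (mul_ne_zero hβ (hu.map (aeval β)).ne_zero) h

/-- Since `F(β⁻¹) = F(β)`, the minimal polynomial of `β⁻¹` has the degree of `g`, which is also that
of the monic polynomial `recip g` vanishing there. -/
theorem irreducible_recip {g : F[X]} (hg : Irreducible g) (hm : g.Monic) {β : L} (hβ : β ≠ 0)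
    (h : aeval β g = 0) : Irreducible (recip g) := by
  have h0 := coeff_zero_ne_zero hg hβ h
  have hint : IsIntegral F β⁻¹ := ⟨recip g, monic_recip h0, aeval_inv_recip hβ h⟩
  have : recip g = minpoly F β⁻¹ := by
    refine eq_of_monic_of_dvd_of_natDegree_le (minpoly.monic hint) (monic_recip h0)
      (minpoly.dvd F _ (aeval_inv_recip hβ h)) ?_
    rw [natDegree_recip h0, ← IntermediateField.adjoin.finrank hint, adjoin_inv,
      finrank_adjoin_of_irreducible hg hm h]
  rw [this]
  exact minpoly.irreducible hint

theorem eq_X_sub_C_of_aeval {g : F[X]} (hg : Irreducible g) (hm : g.Monic) (c : F)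
    (h : aeval (algebraMap F L c) g = 0) : g = X - C c := by
  rw [minpoly.eq_of_irreducible_of_monic hg h hm, minpoly.eq_X_sub_C]

end ConjRecip

/-! ### Frobenius and conjugate roots over finite fields -/

section FiniteFields

variable {F : Type*} [Field F] [Finite F] {L : Type*} [Field L] [Algebra F L]

/-- Two roots of an irreducible polynomial over a finite field differ by a power of Frobenius. -/
theorem exists_eq_pow_card_pow {g : F[X]} (hg : Irreducible g) (hm : g.Monic) {β γ : L}
    (hβ : aeval β g = 0) (hγ : aeval γ g = 0) : ∃ i : ℕ, γ = β ^ (Nat.card F ^ i) := by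
  have hiβ : IsIntegral F β := ⟨g, hm, hβ⟩
  have hiγ : IsIntegral F γ := ⟨g, hm, hγ⟩
  -- In the finite field `F(β, γ)` conjugate elements are related by an automorphism over `F`, and
  -- all of these are powers of Frobenius.
  let E := IntermediateField.adjoin F {β, γ}
  have : FiniteDimensional F E := by
    apply IntermediateField.finiteDimensional_adjoin
    rintro x (rfl | rfl) <;> assumption
  have : Finite E := Module.finite_of_finite F
  let β' : E := ⟨β, IntermediateField.subset_adjoin F _ (by simp)⟩
  let γ' : E := ⟨γ, IntermediateField.subset_adjoin F _ (by simp)⟩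
  have hc : IsConjRoot F γ' β' := by
    have hβ' : aeval β' g = 0 := Subtype.val_injective (by
      simpa using (aeval_algHom_apply E.val β' g).symm.trans hβ)
    have hγ' : aeval γ' g = 0 := Subtype.val_injective (by
      simpa using (aeval_algHom_apply E.val γ' g).symm.trans hγ)
    rw [IsConjRoot, ← minpoly.eq_of_irreducible_of_monic hg hβ' hm,
      ← minpoly.eq_of_irreducible_of_monic hg hγ' hm]
  obtain ⟨σ, hσ⟩ := hc.exists_algEquiv
  let _ := Fintype.ofFinite F
  obtain ⟨i, hi⟩ := (FiniteField.bijective_frobeniusAlgEquivOfAlgebraic_pow F E).2 σ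
  refine ⟨i, ?_⟩
  have h2 := congrArg (Subtype.val) hσ
  rw [← hi, AlgEquiv.coe_pow, FiniteField.coe_frobeniusAlgEquivOfAlgebraic_iterate] at h2
  rw [Nat.card_eq_fintype_card]
  exact h2.symm

theorem pow_pow_of_pow_eq {G : Type*} [Monoid G] {x : G} {N : ℕ} (h : x ^ N = x) (k : ℕ) :
    x ^ (N ^ k) = x := by
  induction k with
  | zero => simp
  | succ k ih => rw [pow_succ, pow_mul, ih, h]

theorem pow_pow_of_pow_eq_inv {G : Type*} [DivisionMonoid G] {x : G} {N : ℕ} (h : x ^ N = x⁻¹)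
    (k : ℕ) : x ^ (N ^ (2 * k + 1)) = x⁻¹ := by
  have h2 : x ^ (N ^ 2) = x := by rw [sq, pow_mul, h, inv_pow, h, inv_inv]
  rw [pow_succ, pow_mul, pow_mul, pow_pow_of_pow_eq h2, h]

/-- A root of an irreducible polynomial over `𝔽_{q²}` that is fixed by conjugation and
reciprocation is its own inverse. -/
theorem inv_eq_self_of_conj_eq_of_recip_eq {q : ℕ} (hF : Nat.card F = q ^ 2) (φ : F →+* F)
    (hφ : ∀ x, φ x = x ^ q) (ψ : L →+* L) (hψ : ∀ x, ψ x = x ^ q) (hq : q ≠ 0) {g : F[X]}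
    (hg : Irreducible g) (hm : g.Monic) {β : L} (hβ : β ≠ 0) (h : aeval β g = 0)
    (hc : g = conj q g) (hr : g = recip g) : β⁻¹ = β := by
  have h1 : aeval (β ^ q) g = 0 := by
    rw [hc, aeval_conj φ hφ ψ hψ, h, zero_pow hq]
  have h2 : aeval β⁻¹ g = 0 := by
    rw [hr]; exact aeval_inv_recip hβ h
  obtain ⟨i, hi⟩ := exists_eq_pow_card_pow hg hm h h1
  obtain ⟨m, hm'⟩ := exists_eq_pow_card_pow hg hm h h2
  rw [hF] at hi hm'
  -- `β ^ q` is also an even power `q ^ (2 * i)` of `β`; cancelling one Frobenius `x ↦ x ^ q` leaves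
  -- an odd exponent of `q` fixing `β`.
  have hodd : ∃ k, β ^ (q ^ (2 * k + 1)) = β := by
    rcases i with _ | i
    · exact ⟨0, by simpa using hi⟩
    · refine ⟨i, ψ.injective ?_⟩
      rw [hψ, hψ, hi, ← pow_mul, ← pow_mul]
      congr 1
  obtain ⟨k, hk⟩ := hodd
  -- The power `q ^ (2 * m * (2 * k + 1))` is evaluated twice: as an odd number of inversions it
  -- gives `β⁻¹`, as iterates of a map fixing `β` it gives `β`.
  have h3 := pow_pow_of_pow_eq_inv hm'.symm k
  have h4 := pow_pow_of_pow_eq hk (2 * m)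
  rw [← h3, ← pow_mul, ← pow_mul]
  rw [← pow_mul] at h4
  convert h4 using 3
  ring

theorem exists_frobenius {q : ℕ} (hq : IsPrimePow q) (hF : Nat.card F = q ^ 2) :
    (∃ φ : F ≃+* F, ∀ x, φ x = x ^ q) ∧ ∃ ψ : L →+* L, ∀ x, ψ x = x ^ q := by
  obtain ⟨p, k, hp, hk, rfl⟩ := hq
  have := Fact.mk hp.nat_prime
  let _ := Fintype.ofFinite F
  have : CharP F p := by
    obtain ⟨p', hp', m, hm, hcard⟩ := FiniteField.card' F
    rw [Nat.card_eq_fintype_card, hcard] at hF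
    have : p' ∣ p := by
      apply hm.dvd_of_dvd_pow (n := k * 2)
      rw [pow_mul, ← hF]
      exact dvd_pow_self _ m.ne_zero
    rwa [← (Nat.prime_dvd_prime_iff_eq hm hp.nat_prime).1 this]
  have : CharP L p := charP_of_injective_algebraMap (algebraMap F L).injective p
  exact ⟨⟨iterateFrobeniusEquiv F p k, fun x => by simp [iterateFrobenius_def]⟩,
    ⟨iterateFrobenius L p k, fun x => iterateFrobenius_def ..⟩⟩

theorem natCast_ne_zero_of_coprime {q n : ℕ} (hF : Nat.card F = q ^ 2)
    (hqn : Nat.Coprime q n) : (n : F) ≠ 0 := by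
  intro h
  have hc : (Nat.card F : F) = 0 := by
    let _ := Fintype.ofFinite F
    rw [Nat.card_eq_fintype_card]; exact FiniteField.cast_card_eq_zero F
  have h1 := ringChar.dvd h
  have h2 := ringChar.dvd hc
  rw [hF] at h2
  have := Nat.Coprime.eq_one_of_dvd ((hqn.pow_left 2).coprime_dvd_left h2) h1
  exact CharP.ringChar_ne_one this

end FiniteFields


/-! ### Dihedral relations and the universal property of the dihedral group -/

/-- The elements `A` and `B` satisfy the defining relations of the dihedral group of
order `2 * n`. -/
structure DihedralRelations {R : Type*} [Monoid R] (n : ℕ) (A B : R) : Prop where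
  pow_eq : A ^ n = 1
  mul_self : B * B = 1
  mul_mul : A * B * A = B

namespace DihedralRelations

variable {R S : Type*} [Monoid R] [Monoid S] {n : ℕ}

theorem map {A B : R} (h : DihedralRelations n A B) (g : R →* S) :
    DihedralRelations n (g A) (g B) where
  pow_eq := by rw [← map_pow, h.pow_eq, map_one]
  mul_self := by rw [← map_mul, h.mul_self, map_one]
  mul_mul := by rw [← map_mul, ← map_mul, h.mul_mul]

theorem of_map {A B : R} (g : R →* S) (hg : Function.Injective g)
    (h : DihedralRelations n (g A) (g B)) : DihedralRelations n A B where
  pow_eq := hg (by rw [map_pow, h.pow_eq, map_one])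
  mul_self := hg (by rw [map_mul, h.mul_self, map_one])
  mul_mul := hg (by rw [map_mul, map_mul, h.mul_mul])

theorem prod {A B : R × S} (h₁ : DihedralRelations n A.1 B.1)
    (h₂ : DihedralRelations n A.2 B.2) : DihedralRelations n A B where
  pow_eq := Prod.ext h₁.pow_eq h₂.pow_eq
  mul_self := Prod.ext h₁.mul_self h₂.mul_self
  mul_mul := Prod.ext h₁.mul_mul h₂.mul_mul

theorem pi {ι : Type*} {T : ι → Type*} [∀ i, Monoid (T i)] {A B : ∀ i, T i}
    (h : ∀ i, DihedralRelations n (A i) (B i)) : DihedralRelations n A B where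
  pow_eq := funext fun i => (h i).pow_eq
  mul_self := funext fun i => (h i).mul_self
  mul_mul := funext fun i => (h i).mul_mul

/-- Inverse-free form of `b a ^ k b = a ^ (-k)`, usable in any monoid; the inner `A * B * A`
collapses to `B` at each step. -/
theorem pow_mul_mul_pow {A B : R} (h : DihedralRelations n A B) (k : ℕ) :
    A ^ k * B * A ^ k = B := by
  induction k with
  | zero => simp
  | succ k ih =>
    calc A ^ (k + 1) * B * A ^ (k + 1) = A ^ k * (A * B * A) * A ^ k := by
          nth_rw 1 [pow_succ]; rw [pow_succ']; simp only [mul_assoc]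
      _ = B := by rw [h.mul_mul, ih]

theorem pow_val_add [NeZero n] {A B : R} (h : DihedralRelations n A B) (i j : ZMod n) :
    A ^ (i + j).val = A ^ i.val * A ^ j.val := by
  rw [ZMod.val_add, ← pow_add, ← pow_eq_pow_mod _ h.pow_eq]

theorem pow_val_mul_mul_pow_val [NeZero n] {A B : R} (h : DihedralRelations n A B)
    (i j : ZMod n) : A ^ i.val * B * A ^ j.val = B * A ^ (j - i).val := by
  conv_lhs => rw [← add_sub_cancel i j]
  rw [h.pow_val_add, ← mul_assoc, h.pow_mul_mul_pow]

/-- The homomorphism from the dihedral group given by elements satisfying its relations. -/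
def lift [NeZero n] {A B : R} (h : DihedralRelations n A B) : DihedralGroup n →* R where
  toFun
    | .r i => A ^ i.val
    | .sr i => B * A ^ i.val
  map_one' := by
    change A ^ (0 : ZMod n).val = 1
    simp
  map_mul' x y := by
    rcases x with i | i <;> rcases y with j | j
    · exact h.pow_val_add i j
    · change B * A ^ (j - i).val = A ^ i.val * (B * A ^ j.val)
      rw [← mul_assoc, h.pow_val_mul_mul_pow_val]
    · change B * A ^ (i + j).val = B * A ^ i.val * A ^ j.val
      rw [h.pow_val_add, mul_assoc]
    · change A ^ (j - i).val = B * A ^ i.val * (B * A ^ j.val)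
      rw [mul_assoc, ← mul_assoc (A ^ i.val), h.pow_val_mul_mul_pow_val, ← mul_assoc,
        h.mul_self, one_mul]

theorem lift_r_one [NeZero n] {A B : R} (h : DihedralRelations n A B) :
    h.lift (.r 1) = A := by
  change A ^ (1 : ZMod n).val = A
  rw [ZMod.val_one_eq_one_mod, ← pow_eq_pow_mod _ h.pow_eq, pow_one]

theorem lift_sr_zero [NeZero n] {A B : R} (h : DihedralRelations n A B) :
    h.lift (.sr 0) = B := by
  change B * A ^ (0 : ZMod n).val = B
  simp

end DihedralRelations

/-! ### Normal form in the group algebra and the isomorphism criterion -/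

section GroupAlgebra

variable {F : Type*} [Field F]

/-- The element `p(A) + B r(A)` of an algebra. -/
noncomputable def evalPair {R : Type*} [Ring R] [Algebra F R] (p r : F[X]) (A B : R) : R :=
  aeval A p + B * aeval A r

theorem map_evalPair {R S : Type*} [Ring R] [Algebra F R] [Ring S] [Algebra F S] (g : R →ₐ[F] S)
    (p r : F[X]) (A B : R) : g (evalPair p r A B) = evalPair p r (g A) (g B) := by
  simp only [evalPair, map_add, map_mul, aeval_algHom_apply]

theorem genA_pow (n : ℕ) (k : ℕ) :
    genA F n ^ k = MonoidAlgebra.of F _ (DihedralGroup.r (k : ZMod n)) := by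
  rw [genA, ← map_pow, DihedralGroup.r_one_pow]

theorem exists_evalPair_eq {n : ℕ} [NeZero n] (x : MonoidAlgebra F (DihedralGroup n)) :
    ∃ p r : F[X], p ∈ degreeLT F n ∧ r ∈ degreeLT F n ∧
      evalPair p r (genA F n) (genB F n) = x := by
  induction x using MonoidAlgebra.induction_linear with
  | zero => exact ⟨0, 0, zero_mem _, zero_mem _, by simp [evalPair]⟩
  | add x y hx hy =>
    obtain ⟨p, r, hp, hr, rfl⟩ := hx
    obtain ⟨p', r', hp', hr', rfl⟩ := hy
    refine ⟨p + p', r + r', add_mem hp hp', add_mem hr hr', ?_⟩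
    simp only [evalPair, map_add, mul_add]
    abel
  | single g c =>
    have hmem (i : ZMod n) : monomial i.val c ∈ degreeLT F n :=
      mem_degreeLT.2 ((degree_monomial_le _ _).trans_lt (by exact_mod_cast ZMod.val_lt i))
    rcases g with i | i
    · refine ⟨monomial i.val c, 0, hmem i, zero_mem _, ?_⟩
      simp [evalPair, aeval_monomial, genA_pow]
    · refine ⟨0, monomial i.val c, zero_mem _, hmem i, ?_⟩
      simp [evalPair, aeval_monomial, genA_pow, genB, MonoidAlgebra.single_mul_single]

theorem finrank_monoidAlgebra (G : Type*) [Monoid G] [Finite G] :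
    Module.finrank F (MonoidAlgebra F G) = Nat.card G := by
  let _ := Fintype.ofFinite G
  rw [(MonoidAlgebra.coeffLinearEquiv F).finrank_eq, Module.finrank_finsupp_self,
    Nat.card_eq_fintype_card]

theorem exists_algEquiv_of_relations {n : ℕ} [NeZero n] {R : Type*} [Ring R] [Algebra F R]
    [Module.Finite F R] {A B : R} (h : DihedralRelations n A B)
    (hR : Module.finrank F R ≤ 2 * n)
    (hinj : ∀ p r : F[X], evalPair p r A B = 0 → X ^ n - 1 ∣ p ∧ X ^ n - 1 ∣ r) :
    ∃ ρ : MonoidAlgebra F (DihedralGroup n) ≃ₐ[F] R,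
      ρ (genA F n) = A ∧ ρ (genB F n) = B := by
  let φ : MonoidAlgebra F (DihedralGroup n) →ₐ[F] R := MonoidAlgebra.lift F R _ h.lift
  have hA : φ (genA F n) = A := by simp [φ, genA, h.lift_r_one]
  have hB : φ (genB F n) = B := by simp [φ, genB, h.lift_sr_zero]
  have hdeg {p : F[X]} (hp : p ∈ degreeLT F n) (hd : X ^ n - 1 ∣ p) : p = 0 := by
    refine eq_zero_of_dvd_of_degree_lt hd ?_
    rw [← C_1, degree_X_pow_sub_C (NeZero.pos n)]
    exact mem_degreeLT.1 hp
  have hφ : Function.Injective φ := by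
    rw [injective_iff_map_eq_zero]
    intro x hx
    obtain ⟨p, r, hp, hr, rfl⟩ := exists_evalPair_eq x
    rw [map_evalPair, hA, hB] at hx
    obtain ⟨h1, h2⟩ := hinj p r hx
    simp [evalPair, hdeg hp h1, hdeg hr h2]
  have hfin : Module.finrank F (MonoidAlgebra F (DihedralGroup n)) = 2 * n := by
    rw [finrank_monoidAlgebra, DihedralGroup.nat_card]
  have : Module.Finite F (MonoidAlgebra F (DihedralGroup n)) :=
    Module.finite_of_finrank_pos (by rw [hfin]; have := NeZero.pos n; omega)
  -- Injectivity forces the dimension of `R` to be at least `2 * n`, so the assumed upper bound is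
  -- an equality and surjectivity follows.
  have heq := le_antisymm (LinearMap.finrank_le_finrank_of_injective (f := φ.toLinearMap) hφ)
    (hR.trans hfin.ge)
  have hsurj : Function.Surjective φ :=
    (LinearMap.injective_iff_surjective_of_finrank_eq_finrank (f := φ.toLinearMap) heq).1 hφ
  exact ⟨AlgEquiv.ofBijective φ ⟨hφ, hsurj⟩, hA, hB⟩

end GroupAlgebra

/-! ### The two-by-two blocks and their descent to smaller fields -/

section Matrices

variable {F : Type*} [Field F] {L : Type*} [Field L] [Algebra F L]

theorem diagInv_eq_diagonalAlgHom (β : L) :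
    diagInv β = Matrix.diagonalAlgHom F ![β, β⁻¹] := by
  ext i j
  fin_cases i <;> fin_cases j <;> simp [diagInv]

theorem aeval_diagInv (β : L) (p : F[X]) :
    aeval (diagInv β) p = !![aeval β p, 0; 0, aeval β⁻¹ p] := by
  rw [diagInv_eq_diagonalAlgHom (F := F), aeval_algHom_apply]
  ext i j
  fin_cases i <;> fin_cases j <;> simp [aeval_pi_apply]

/-- The diagonal part carries the values of `p`, and the swap puts those of `r` off the diagonal, so
nothing can cancel. -/
theorem aeval_eq_zero_of_evalPair_diagInv {β : L} {p r : F[X]}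
    (h : evalPair p r (diagInv β) (swap L) = 0) :
    (aeval β p = 0 ∧ aeval β⁻¹ p = 0) ∧ aeval β r = 0 ∧ aeval β⁻¹ r = 0 := by
  rw [evalPair, aeval_diagInv, aeval_diagInv, swap] at h
  have h00 := congrFun (congrFun h 0) 0
  have h01 := congrFun (congrFun h 0) 1
  have h10 := congrFun (congrFun h 1) 0
  have h11 := congrFun (congrFun h 1) 1
  simp at h00 h01 h10 h11
  exact ⟨⟨h00, h11⟩, h10, h01⟩

theorem dihedralRelations_diagInv {n : ℕ} {β : L} (hβ : β ≠ 0) (h : β ^ n = 1) :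
    DihedralRelations n (diagInv β) (swap L) where
  pow_eq := by
    have : ![β, β⁻¹] ^ n = 1 := by
      ext i
      fin_cases i <;> simp [h]
    rw [diagInv_eq_diagonalAlgHom (F := L), ← map_pow, this, map_one]
  mul_self := by simp [swap, Matrix.one_fin_two]
  mul_mul := by simp [swap, diagInv, hβ]

theorem det_Z (β : L) : (Z β).det = β - β⁻¹ := by
  simp [Z, Matrix.det_fin_two]
  ring

theorem isUnit_det_Z {β : L} (h : β⁻¹ ≠ β) : IsUnit (Z β).det := by
  rw [det_Z]
  exact (sub_ne_zero.2 h.symm).isUnit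

variable (F) in
/-- Conjugation by `Z β` as an algebra automorphism. -/
noncomputable def sigmaEquiv {β : L} (h : β⁻¹ ≠ β) :
    Matrix (Fin 2) (Fin 2) L ≃ₐ[F] Matrix (Fin 2) (Fin 2) L :=
  AlgEquiv.ofLinearEquiv
    { toFun := sigma β
      invFun := fun M => Z β * M * (Z β)⁻¹
      map_add' := fun M N => by simp [sigma, mul_add, add_mul]
      map_smul' := fun c M => by simp [sigma]
      left_inv := fun M => by
        simp [sigma, ← mul_assoc, Matrix.mul_nonsing_inv _ (isUnit_det_Z h),
          Matrix.mul_nonsing_inv_cancel_right _ _ (isUnit_det_Z h)]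
      right_inv := fun M => by
        simp [sigma, ← mul_assoc, Matrix.nonsing_inv_mul _ (isUnit_det_Z h),
          Matrix.nonsing_inv_mul_cancel_right _ _ (isUnit_det_Z h)] }
    (by change sigma β 1 = 1; simp [sigma, Matrix.nonsing_inv_mul _ (isUnit_det_Z h)])
    (fun M N => by
      change sigma β (M * N) = sigma β M * sigma β N
      simp [sigma, ← mul_assoc, Matrix.mul_nonsing_inv_cancel_right _ _ (isUnit_det_Z h)])

theorem sigma_eq_iff {β : L} (h : β⁻¹ ≠ β) (M N : Matrix (Fin 2) (Fin 2) L) :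
    sigma β M = N ↔ M * Z β = Z β * N := by
  constructor
  · rintro rfl
    simp [sigma, ← mul_assoc, Matrix.mul_nonsing_inv _ (isUnit_det_Z h)]
  · intro hM
    rw [sigma, mul_assoc, hM, ← mul_assoc, Matrix.nonsing_inv_mul _ (isUnit_det_Z h), one_mul]

/-- The result is a companion matrix of `x² - (β + β⁻¹) x + 1`, whose entries no longer involve `β`
alone. This is the purpose of `Z β`. -/
theorem sigma_diagInv {β : L} (hβ : β ≠ 0) (h : β⁻¹ ≠ β) :
    sigma β (diagInv β) = !![0, 1; -1, β + β⁻¹] := by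
  rw [sigma_eq_iff h, Z, diagInv]
  ext i j
  fin_cases i <;> fin_cases j <;> simp <;> field_simp <;> ring

theorem sigma_swap {β : L} (h : β⁻¹ ≠ β) :
    sigma β (swap L) = !![1, -(β + β⁻¹); 0, -1] := by
  rw [sigma_eq_iff h, Z, swap]
  ext i j
  fin_cases i <;> fin_cases j <;> simp

/-- The inclusion of `M₂(F(β))` in `M₂(L)` as an algebra homomorphism. -/
noncomputable def inclHom (β : L) : M₂ F β →ₐ[F] Matrix (Fin 2) (Fin 2) L :=
  (IntermediateField.adjoin F {β}).val.mapMatrix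

theorem inclHom_injective (β : L) : Function.Injective (inclHom (F := F) β) :=
  Matrix.map_injective Subtype.val_injective

theorem exists_incl_eq {β : L} {M : Matrix (Fin 2) (Fin 2) L}
    (h : ∀ i j, M i j ∈ IntermediateField.adjoin F {β}) : ∃ N : M₂ F β, N.incl = M :=
  ⟨fun i j => ⟨M i j, h i j⟩, rfl⟩

theorem exists_incl_eq_diagInv (β : L) : ∃ N : M₂ F β, N.incl = diagInv β := by
  have := IntermediateField.mem_adjoin_simple_self F β
  refine exists_incl_eq fun i j => ?_
  fin_cases i <;> fin_cases j <;> simp [diagInv, this]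

theorem exists_incl_eq_swap (β : L) : ∃ N : M₂ F β, N.incl = swap L := by
  refine exists_incl_eq fun i j => ?_
  fin_cases i <;> fin_cases j <;> simp [swap]

theorem exists_incl_eq_sigma_diagInv {β : L} (hβ : β ≠ 0) (h : β⁻¹ ≠ β) :
    ∃ N : M₂ F (β + β⁻¹), N.incl = sigma β (diagInv β) := by
  have := IntermediateField.mem_adjoin_simple_self F (β + β⁻¹)
  rw [sigma_diagInv hβ h]
  refine exists_incl_eq fun i j => ?_
  fin_cases i <;> fin_cases j <;> simp [this]

theorem exists_incl_eq_sigma_swap {β : L} (h : β⁻¹ ≠ β) :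
    ∃ N : M₂ F (β + β⁻¹), N.incl = sigma β (swap L) := by
  have := neg_mem (IntermediateField.mem_adjoin_simple_self F (β + β⁻¹))
  rw [sigma_swap h]
  refine exists_incl_eq fun i j => ?_
  fin_cases i <;> fin_cases j <;> simp [-neg_add_rev, this]

end Matrices


/-! ### Degrees of the coefficient fields -/

section Degrees

variable {F : Type*} [Field F] {L : Type*} [Field L] [Algebra F L]

theorem eq_X_sub_one_or_eq_X_add_one {g : F[X]} (hg : Irreducible g) (hm : g.Monic) {β : L}
    (hβ : β ≠ 0) (h : aeval β g = 0) (hinv : β⁻¹ = β) : g = X - 1 ∨ g = X + 1 := by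
  have h1 : β * β = 1 := by
    nth_rw 1 [← hinv]
    exact inv_mul_cancel₀ hβ
  rcases mul_self_eq_one_iff.1 h1 with rfl | rfl
  · left
    simpa using eq_X_sub_C_of_aeval (L := L) hg hm 1 (by simpa using h)
  · right
    simpa using eq_X_sub_C_of_aeval (L := L) hg hm (-1) (by simpa using h)

/-- A self-inverse root is `1` or `-1`, so `g` would be `X - 1` or `X + 1`, both invariant under
conjugation. -/
theorem inv_ne_self_of_ne_conj {q : ℕ} (φ : F →+* F) (hφ : ∀ x, φ x = x ^ q) {g : F[X]}
    (hg : Irreducible g) (hm : g.Monic) {β : L} (hβ : β ≠ 0) (h : aeval β g = 0)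
    (hc : g ≠ conj q g) : β⁻¹ ≠ β := by
  intro hinv
  apply hc
  rw [conj_eq_map φ hφ]
  rcases eq_X_sub_one_or_eq_X_add_one hg hm hβ h hinv with rfl | rfl <;> simp

theorem finiteDimensional_adjoin {g : F[X]} (hm : g.Monic) {β : L} (h : aeval β g = 0) :
    FiniteDimensional F (IntermediateField.adjoin F {β}) :=
  IntermediateField.adjoin.finiteDimensional ⟨g, hm, h⟩

theorem finrank_adjoin_le_of_mem {β γ : L} [FiniteDimensional F (IntermediateField.adjoin F {β})]
    (h : γ ∈ IntermediateField.adjoin F {β}) :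
    Module.finrank F (IntermediateField.adjoin F {γ}) ≤
      Module.finrank F (IntermediateField.adjoin F {β}) :=
  Nat.le_of_dvd Module.finrank_pos
    (IntermediateField.finrank_dvd_of_le_right (IntermediateField.adjoin_simple_le_iff.2 h))

/-- If `β⁻¹ ≠ β` is conjugate to `β`, then `F(β + β⁻¹)` is a proper subfield of `F(β)`. -/
theorem two_mul_finrank_adjoin_add_inv_le [Finite F] {g : F[X]} (hg : Irreducible g)
    (hm : g.Monic) {β : L} (h : aeval β g = 0) (h' : aeval β⁻¹ g = 0) (hinv : β⁻¹ ≠ β) :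
    2 * Module.finrank F (IntermediateField.adjoin F {β + β⁻¹}) ≤ g.natDegree := by
  have hfin := finiteDimensional_adjoin hm h
  rw [← finrank_adjoin_of_irreducible hg hm h]
  have hmem := IntermediateField.mem_adjoin_simple_self F β
  have hle : IntermediateField.adjoin F {β + β⁻¹} ≤ IntermediateField.adjoin F {β} :=
    IntermediateField.adjoin_simple_le_iff.2 (add_mem hmem (inv_mem hmem))
  obtain ⟨k, hk⟩ := IntermediateField.finrank_dvd_of_le_right hle
  have hpos : 0 < Module.finrank F (IntermediateField.adjoin F {β}) := Module.finrank_pos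
  -- `k` is the degree of `F(β)` over `F(β + β⁻¹)`: zero contradicts positivity, one would put `β`
  -- in the subfield, and anything larger gives the bound.
  rcases k with _ | _ | k
  · omega
  · exfalso
    apply hinv
    have hmem' : β ∈ IntermediateField.adjoin F {β + β⁻¹} := by
      rw [IntermediateField.eq_of_le_of_finrank_eq hle (by simpa using hk.symm)]
      exact hmem
    have hint : IsIntegral F (β + β⁻¹) :=
      IsIntegral.add ⟨g, hm, h⟩ ⟨g, hm, h'⟩
    rw [← IntermediateField.mem_toSubalgebra,
      IntermediateField.adjoin_simple_toSubalgebra_of_isAlgebraic hint.isAlgebraic,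
      Algebra.adjoin_singleton_eq_range_aeval] at hmem'
    obtain ⟨p, hp⟩ := hmem'
    -- A power of Frobenius sends `β` to `β⁻¹`, hence fixes `β + β⁻¹` and every polynomial in it, in
    -- particular `β`: a contradiction.
    obtain ⟨i, hi⟩ := exists_eq_pow_card_pow hg hm h h'
    let _ := Fintype.ofFinite F
    let σ : L →ₐ[F] L := FiniteField.frobeniusAlgHom F L ^ i
    have hσ : σ β = β⁻¹ := by
      simp only [σ, AlgHom.coe_pow, FiniteField.coe_frobeniusAlgHom, pow_iterate]
      rw [hi, Nat.card_eq_fintype_card]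
    rw [← hσ]
    have hp' : aeval (β + β⁻¹) p = β := hp
    nth_rw 1 [← hp']
    rw [← aeval_algHom_apply, map_add, map_inv₀, hσ, inv_inv, add_comm, hp']
  · rw [hk]
    nlinarith

theorem finrank_M₂ (β : L) :
    Module.finrank F (M₂ F β) = 4 * Module.finrank F (IntermediateField.adjoin F {β}) := by
  rw [Module.finrank_matrix]
  simp

end Degrees

/-! ### Relations and kernel conditions, block by block -/

section Blocks

variable {F : Type*} [Field F] {L : Type*} [Field L] [Algebra F L]

section EvalPair

variable {R S : Type*} [Ring R] [Algebra F R] [Ring S] [Algebra F S]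

theorem evalPair_fst (p r : F[X]) (A B : R × S) :
    (evalPair p r A B).1 = evalPair p r A.1 B.1 :=
  map_evalPair (AlgHom.fst F R S) p r A B

theorem evalPair_snd (p r : F[X]) (A B : R × S) :
    (evalPair p r A B).2 = evalPair p r A.2 B.2 :=
  map_evalPair (AlgHom.snd F R S) p r A B

theorem evalPair_apply {ι : Type*} {T : ι → Type*} [∀ i, Ring (T i)] [∀ i, Algebra F (T i)]
    (p r : F[X]) (A B : ∀ i, T i) (i : ι) :
    evalPair p r A B i = evalPair p r (A i) (B i) :=
  map_evalPair (Pi.evalAlgHom F T i) p r A B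

theorem incl_evalPair {β : L} (p r : F[X]) (A B : M₂ F β) :
    (evalPair p r A B).incl = evalPair p r A.incl B.incl :=
  map_evalPair (inclHom β) p r A B

theorem evalPair_sigma {β : L} (h : β⁻¹ ≠ β) (p r : F[X]) (A B : Matrix (Fin 2) (Fin 2) L)
    (h0 : evalPair p r (sigma β A) (sigma β B) = 0) : evalPair p r A B = 0 := by
  have := map_evalPair (sigmaEquiv F h).toAlgHom p r A B
  exact (map_eq_zero_iff _ (sigmaEquiv F h).injective).1 (this.trans h0)

end EvalPair

/-- The relations can thus be checked over `L`, where the conjugating matrix `Z β` is available. -/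
theorem DihedralRelations.of_incl {n : ℕ} {β : L} {A B : M₂ F β}
    (h : DihedralRelations n A.incl B.incl) : DihedralRelations n A B :=
  of_map (R := M₂ F β) (MonoidHomClass.toMonoidHom (inclHom (F := F) β)) (inclHom_injective β) h

theorem dihedralRelations_sigma {n : ℕ} {β : L} (h : β⁻¹ ≠ β)
    {A B : Matrix (Fin 2) (Fin 2) L} (hAB : DihedralRelations n A B) :
    DihedralRelations n (sigma β A) (sigma β B) :=
  hAB.map (MonoidHomClass.toMonoidHom (sigmaEquiv L h))

variable {J : Type*} [Fintype J] {q n : ℕ} {f : J → F[X]} {α : J → L}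

theorem exists_isGeneratorImage (h0 : ∀ j, α j ≠ 0)
    (h1 : ∀ j ∈ J₁ q f, (α j)⁻¹ ≠ α j ∧ (α j ^ q)⁻¹ ≠ α j ^ q) :
    ∃ A B : MatrixBlocks q f α, IsGeneratorImage q f α A B := by
  have hq (j) : α j ^ q ≠ 0 := pow_ne_zero q (h0 j)
  choose a₁ ha₁ using fun j : {j // j ∈ J₁ q f} =>
    exists_incl_eq_sigma_diagInv (F := F) (h0 j) (h1 j j.2).1
  choose a₁' ha₁' using fun j : {j // j ∈ J₁ q f} =>
    exists_incl_eq_sigma_diagInv (F := F) (hq j) (h1 j j.2).2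
  choose b₁ hb₁ using fun j : {j // j ∈ J₁ q f} =>
    exists_incl_eq_sigma_swap (F := F) (h1 j j.2).1
  choose b₁' hb₁' using fun j : {j // j ∈ J₁ q f} =>
    exists_incl_eq_sigma_swap (F := F) (h1 j j.2).2
  choose d hd using fun β : L => exists_incl_eq_diagInv (F := F) β
  choose s hs using fun β : L => exists_incl_eq_swap (F := F) β
  exact ⟨⟨fun j => (a₁ j, a₁' j), fun j => d _, fun j => (d _, d _)⟩,
    ⟨fun j => (b₁ j, b₁' j), fun j => s _, fun j => (s _, s _)⟩,
    fun j => ⟨ha₁ j, ha₁' j⟩, fun j => ⟨hb₁ j, hb₁' j⟩, fun j => hd _, fun j => hs _,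
    fun j => ⟨hd _, hd _⟩, fun j => ⟨hs _, hs _⟩⟩

theorem IsGeneratorImage.dihedralRelations {A B : MatrixBlocks q f α}
    (h : IsGeneratorImage q f α A B) (h0 : ∀ j, α j ≠ 0)
    (h1 : ∀ j ∈ J₁ q f, (α j)⁻¹ ≠ α j ∧ (α j ^ q)⁻¹ ≠ α j ^ q) (hn : ∀ j, α j ^ n = 1) :
    DihedralRelations n A B := by
  have hq (j) : α j ^ q ≠ 0 := pow_ne_zero q (h0 j)
  have hnq (j) : (α j ^ q) ^ n = 1 := by rw [pow_right_comm, hn, one_pow]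
  refine .prod (.pi fun j => .prod ?_ ?_) (.prod (.pi fun j => ?_) (.pi fun j => .prod ?_ ?_)) <;>
    apply DihedralRelations.of_incl
  · rw [(h.a_J₁ j).1, (h.b_J₁ j).1]
    exact dihedralRelations_sigma (h1 j j.2).1 (dihedralRelations_diagInv (h0 j) (hn j))
  · rw [(h.a_J₁ j).2, (h.b_J₁ j).2]
    exact dihedralRelations_sigma (h1 j j.2).2 (dihedralRelations_diagInv (hq j) (hnq j))
  · rw [h.a_J₂₃, h.b_J₂₃]
    exact dihedralRelations_diagInv (h0 j) (hn j)
  · rw [(h.a_J₄ j).1, (h.b_J₄ j).1]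
    exact dihedralRelations_diagInv (h0 j) (hn j)
  · rw [(h.a_J₄ j).2, (h.b_J₄ j).2]
    exact dihedralRelations_diagInv (hq j) (hnq j)

/-- `p` and `r` both vanish at `β` and at `β⁻¹`. -/
def VanishAt (p r : F[X]) (β : L) : Prop :=
  (aeval β p = 0 ∧ aeval β⁻¹ p = 0) ∧ aeval β r = 0 ∧ aeval β⁻¹ r = 0

theorem IsGeneratorImage.vanishAt {A B : MatrixBlocks q f α}
    (h : IsGeneratorImage q f α A B)
    (h1 : ∀ j ∈ J₁ q f, (α j)⁻¹ ≠ α j ∧ (α j ^ q)⁻¹ ≠ α j ^ q) {p r : F[X]}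
    (hpr : evalPair p r A B = 0) :
    (∀ j ∈ J₁ q f, VanishAt p r (α j) ∧ VanishAt p r (α j ^ q)) ∧
    (∀ j, j ∈ J₂ q f ∨ j ∈ J₃ q f → VanishAt p r (α j)) ∧
    (∀ j ∈ J₄ q f, VanishAt p r (α j) ∧ VanishAt p r (α j ^ q)) := by
  have hpr₁ := congrArg Prod.fst hpr
  have hpr₂ := congrArg (fun x => x.2.1) hpr
  have hpr₃ := congrArg (fun x => x.2.2) hpr
  simp only [evalPair_fst, evalPair_snd] at hpr₁ hpr₂ hpr₃
  refine ⟨fun j hj => ⟨?_, ?_⟩, fun j hj => ?_, fun j hj => ⟨?_, ?_⟩⟩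
  · have := congrArg (fun x => M₂.incl (x ⟨j, hj⟩).1) hpr₁
    simp only [evalPair_apply, evalPair_fst, incl_evalPair, (h.a_J₁ _).1, (h.b_J₁ _).1] at this
    exact aeval_eq_zero_of_evalPair_diagInv
      (evalPair_sigma (h1 j hj).1 _ _ _ _ (this.trans (map_zero (inclHom (F := F) (α j + (α j)⁻¹)))))
  · have := congrArg (fun x => M₂.incl (x ⟨j, hj⟩).2) hpr₁
    simp only [evalPair_apply, evalPair_snd, incl_evalPair, (h.a_J₁ _).2, (h.b_J₁ _).2] at this
    exact aeval_eq_zero_of_evalPair_diagInv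
      (evalPair_sigma (h1 j hj).2 _ _ _ _ (this.trans (map_zero (inclHom (F := F) (α j ^ q + (α j ^ q)⁻¹)))))
  · have := congrArg (fun x => M₂.incl (x ⟨j, hj⟩)) hpr₂
    simp only [evalPair_apply, incl_evalPair, h.a_J₂₃, h.b_J₂₃] at this
    exact aeval_eq_zero_of_evalPair_diagInv (this.trans (map_zero (inclHom (F := F) (α j))))
  · have := congrArg (fun x => M₂.incl (x ⟨j, hj⟩).1) hpr₃
    simp only [evalPair_apply, evalPair_fst, incl_evalPair, (h.a_J₄ _).1, (h.b_J₄ _).1] at this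
    exact aeval_eq_zero_of_evalPair_diagInv (this.trans (map_zero (inclHom (F := F) (α j))))
  · have := congrArg (fun x => M₂.incl (x ⟨j, hj⟩).2) hpr₃
    simp only [evalPair_apply, evalPair_snd, incl_evalPair, (h.a_J₄ _).2, (h.b_J₄ _).2] at this
    exact aeval_eq_zero_of_evalPair_diagInv (this.trans (map_zero (inclHom (F := F) (α j ^ q))))

end Blocks

/-! ### Divisibility and degree count from the factorisation -/

section Factorisation

variable {F : Type*} [Field F] {L : Type*} [Field L] [Algebra F L]
  {J : Type*} [Fintype J] {q n : ℕ} {f : J → F[X]} {α : J → L}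

theorem mem_cases (q : ℕ) (f : J → F[X]) (j : J) :
    j ∈ J₀ q f ∨ j ∈ J₁ q f ∨ j ∈ J₂ q f ∨ j ∈ J₃ q f ∨ j ∈ J₄ q f := by
  simp only [J₀, J₁, J₂, J₃, J₄, Finset.mem_filter, Finset.mem_univ, true_and]
  by_cases h1 : f j = conj q (f j) <;> by_cases h2 : f j = recip (f j) <;> tauto

theorem disjoint_J₂_J₃ (q : ℕ) (f : J → F[X]) : Disjoint (J₂ q f) (J₃ q f) := by
  classical
  simp only [J₂, J₃, Finset.disjoint_filter]
  rintro j - ⟨h1, h2⟩ ⟨h3, -⟩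
  exact h2 (h1.trans h3)

namespace IsRefinedFactorisation

theorem dvd (hf : IsRefinedFactorisation q n f) (j : J) : f j ∣ X ^ n - 1 := by
  rw [hf.prod_eq]
  rcases mem_cases q f j with h | h | h | h | h
  · exact (Finset.dvd_prod_of_mem _ h).trans
      (((dvd_mul_right _ _).mul_right _).mul_right _)
  · exact (((dvd_mul_right _ _).trans (Finset.dvd_prod_of_mem (fun j => f j * conj q (f j)) h)).trans
      (((dvd_mul_left _ _).mul_right _).mul_right _))
  · exact (((dvd_mul_right _ _).trans (Finset.dvd_prod_of_mem (fun j => f j * recip (f j)) h)).trans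
      (((dvd_mul_right _ _).mul_left _).mul_right _))
  · exact (((dvd_mul_right _ _).trans (Finset.dvd_prod_of_mem (fun j => f j * recip (f j)) h)).trans
      (((dvd_mul_left _ _).mul_left _).mul_right _))
  · refine Dvd.dvd.mul_left (Dvd.dvd.trans ?_ (Finset.dvd_prod_of_mem
      (fun j => f j * recip (f j) * conj q (f j) * dagger q (f j)) h)) _
    exact ((dvd_mul_right _ _).mul_right _).mul_right _

theorem pow_eq_one (hf : IsRefinedFactorisation q n f) (hα : ∀ j, aeval (α j) (f j) = 0) (j : J) :
    α j ^ n = 1 := by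
  obtain ⟨g, hg⟩ := hf.dvd j
  have := congrArg (aeval (α j)) hg
  rw [map_mul, hα, zero_mul] at this
  simpa [sub_eq_zero] using this

theorem ne_zero (hf : IsRefinedFactorisation q n f) (hα : ∀ j, aeval (α j) (f j) = 0)
    (hn : n ≠ 0) (j : J) : α j ≠ 0 := by
  intro h
  have := hf.pow_eq_one hα j
  simp [h, hn] at this

/-- Pairwise coprimality of the factors is not needed: their product divides a power of `p`, and a
squarefree divisor of a power of `p` divides `p`. -/
theorem dvd_of_forall (hf : IsRefinedFactorisation q n f) (hn : (n : F) ≠ 0) {p : F[X]}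
    (h₀ : ∀ j ∈ J₀ q f, f j ∣ p)
    (h₁ : ∀ j ∈ J₁ q f, f j ∣ p ∧ conj q (f j) ∣ p)
    (h₂₃ : ∀ j, j ∈ J₂ q f ∨ j ∈ J₃ q f → f j ∣ p ∧ recip (f j) ∣ p)
    (h₄ : ∀ j ∈ J₄ q f, (f j ∣ p ∧ recip (f j) ∣ p) ∧ conj q (f j) ∣ p ∧ dagger q (f j) ∣ p) :
    X ^ n - 1 ∣ p := by
  have hsq : Squarefree ((X : F[X]) ^ n - 1) := by
    have := (separable_X_pow_sub_C (1 : F) hn one_ne_zero).squarefree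
    rwa [C_1] at this
  have hprod {s : Finset J} {g : J → F[X]} {m : ℕ} (h : ∀ j ∈ s, g j ∣ p ^ m) :
      ∏ j ∈ s, g j ∣ p ^ (m * s.card) := by
    rw [pow_mul, ← Finset.prod_const]
    exact Finset.prod_dvd_prod_of_dvd _ _ h
  have hsplit : (X : F[X]) ^ n - 1 ∣ p ^ (1 * (J₀ q f).card + 2 * (J₁ q f).card +
      (2 * (J₂ q f).card + 2 * (J₃ q f).card) + 4 * (J₄ q f).card) := by
    rw [hf.prod_eq]
    simp only [pow_add]
    refine mul_dvd_mul (mul_dvd_mul (mul_dvd_mul ?_ ?_) (mul_dvd_mul ?_ ?_)) ?_ <;>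
      refine hprod fun j hj => ?_
    · simpa using h₀ j hj
    · rw [sq]
      exact mul_dvd_mul (h₁ j hj).1 (h₁ j hj).2
    · rw [sq]
      exact mul_dvd_mul (h₂₃ j (.inl hj)).1 (h₂₃ j (.inl hj)).2
    · rw [sq]
      exact mul_dvd_mul (h₂₃ j (.inr hj)).1 (h₂₃ j (.inr hj)).2
    · obtain ⟨⟨a, b⟩, c, d⟩ := h₄ j hj
      have := mul_dvd_mul (mul_dvd_mul (mul_dvd_mul a b) c) d
      rwa [show p * p * p * p = p ^ 4 by ring] at this
  -- The exponent is raised by one so that it is visibly nonzero.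
  exact (hsq.dvd_pow_iff_dvd (Nat.succ_ne_zero _)).1
    (hsplit.trans (pow_dvd_pow _ (Nat.le_succ _)))

theorem sum_natDegree (hf : IsRefinedFactorisation q n f) (φ : F →+* F)
    (hφ : ∀ x, φ x = x ^ q) (h0 : ∀ j, (f j).coeff 0 ≠ 0) :
    n = ∑ j ∈ J₀ q f, (f j).natDegree + ∑ j ∈ J₁ q f, 2 * (f j).natDegree +
      (∑ j ∈ J₂ q f, 2 * (f j).natDegree + ∑ j ∈ J₃ q f, 2 * (f j).natDegree) +
      ∑ j ∈ J₄ q f, 4 * (f j).natDegree := by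
  have hm := hf.monic
  have hc (j) := monic_conj φ hφ (hm j)
  have hr (j) := monic_recip (h0 j)
  have hd (j) : (dagger q (f j)).Monic := monic_conj φ hφ (hr j)
  have hdd (j) : (dagger q (f j)).natDegree = (f j).natDegree := by
    rw [dagger, natDegree_conj φ hφ, natDegree_recip (h0 j)]
  have h2 (j) := (hm j).mul (hr j)
  have h4 (j) := ((h2 j).mul (hc j)).mul (hd j)
  have m0 : (∏ j ∈ J₀ q f, f j).Monic := monic_prod_of_monic _ _ fun j _ => hm j
  have m1 : (∏ j ∈ J₁ q f, f j * conj q (f j)).Monic :=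
    monic_prod_of_monic _ _ fun j _ => (hm j).mul (hc j)
  have m2 (s : Finset J) : (∏ j ∈ s, f j * recip (f j)).Monic :=
    monic_prod_of_monic _ _ fun j _ => h2 j
  have m4 : (∏ j ∈ J₄ q f, f j * recip (f j) * conj q (f j) * dagger q (f j)).Monic :=
    monic_prod_of_monic _ _ fun j _ => h4 j
  have := congrArg natDegree hf.prod_eq
  rw [← C_1, natDegree_X_pow_sub_C, ((m0.mul m1).mul ((m2 _).mul (m2 _))).natDegree_mul m4,
    (m0.mul m1).natDegree_mul ((m2 _).mul (m2 _)), m0.natDegree_mul m1,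
    (m2 _).natDegree_mul (m2 _), natDegree_prod_of_monic _ _ fun j _ => hm j,
    natDegree_prod_of_monic _ _ fun j _ => (hm j).mul (hc j),
    natDegree_prod_of_monic _ _ fun j _ => h2 j, natDegree_prod_of_monic _ _ fun j _ => h2 j,
    natDegree_prod_of_monic _ _ fun j _ => h4 j] at this
  rw [this]
  have e1 (j) : (f j * conj q (f j)).natDegree = 2 * (f j).natDegree := by
    rw [(hm j).natDegree_mul (hc j), natDegree_conj φ hφ]
    ring
  have e2 (j) : (f j * recip (f j)).natDegree = 2 * (f j).natDegree := by
    rw [(hm j).natDegree_mul (hr j), natDegree_recip (h0 j)]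
    ring
  have e4 (j) : (f j * recip (f j) * conj q (f j) * dagger q (f j)).natDegree =
      4 * (f j).natDegree := by
    rw [((h2 j).mul (hc j)).natDegree_mul (hd j), (h2 j).natDegree_mul (hc j), e2,
      natDegree_conj φ hφ, hdd]
    ring
  simp only [e1, e2, e4]

end IsRefinedFactorisation

end Factorisation


/-! ### Assembling the isomorphism -/

section Assembly

variable {F : Type*} [Field F] {L : Type*} [Field L] [Algebra F L]
  {J : Type*} [Fintype J] {q n : ℕ} {f : J → F[X]} {α : J → L}

theorem mem_J₁ {j : J} : j ∈ J₁ q f ↔ f j = recip (f j) ∧ f j ≠ conj q (f j) := by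
  simp [J₁]

theorem mem_J₀ {j : J} : j ∈ J₀ q f ↔ f j = conj q (f j) ∧ f j = recip (f j) := by
  simp [J₀]

/-- A full matrix block costs four times its field degree. In `J₁` the two fields have degree at
most `d j / 2` each; in `J₄` the second lies inside `F(α j)`. -/
theorem finrank_matrixBlocks_le [∀ j, FiniteDimensional F (IntermediateField.adjoin F {α j})]
    (d : J → ℕ) (hd : ∀ j, Module.finrank F (IntermediateField.adjoin F {α j}) = d j)
    (h₁ : ∀ j ∈ J₁ q f, 2 * Module.finrank F (IntermediateField.adjoin F {α j + (α j)⁻¹}) ≤ d j ∧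
      2 * Module.finrank F (IntermediateField.adjoin F {α j ^ q + (α j ^ q)⁻¹}) ≤ d j) :
    Module.Finite F (MatrixBlocks q f α) ∧ Module.finrank F (MatrixBlocks q f α) ≤
      ∑ j ∈ J₁ q f, 4 * d j + ((∑ j ∈ J₂ q f, 4 * d j + ∑ j ∈ J₃ q f, 4 * d j) +
        ∑ j ∈ J₄ q f, 8 * d j) := by
  classical
  have hmem (j) := IntermediateField.mem_adjoin_simple_self F (α j)
  have hfin {j : J} {β : L} (hβ : β ∈ IntermediateField.adjoin F {α j}) :
      FiniteDimensional F (IntermediateField.adjoin F {β}) :=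
    FiniteDimensional.of_injective
      (IntermediateField.inclusion (IntermediateField.adjoin_simple_le_iff.2 hβ)).toLinearMap
      (IntermediateField.inclusion_injective (IntermediateField.adjoin_simple_le_iff.2 hβ))
  have hpow (j) : α j ^ q ∈ IntermediateField.adjoin F {α j} := pow_mem (hmem j) q
  have i1 (j) := hfin (add_mem (hmem j) (inv_mem (hmem j)))
  have i2 (j) := hfin (add_mem (hpow j) (inv_mem (hpow j)))
  have i3 (j) := hfin (hpow j)
  have hM {β : L} (h : FiniteDimensional F (IntermediateField.adjoin F {β})) :
      Module.Finite F (M₂ F β) := Module.Finite.matrix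
  have f0 (j) := hM (β := α j) inferInstance
  have f1 (j) := hM (i1 j)
  have f2 (j) := hM (i2 j)
  have f3 (j) := hM (i3 j)
  have hfree (M : Type _) [AddCommGroup M] [Module F M] : Module.Free F M :=
    Module.Free.of_divisionRing F M
  have p1 : Module.Finite F ((j : {j // j ∈ J₁ q f}) →
      M₂ F (α j + (α j)⁻¹) × M₂ F ((α j) ^ q + ((α j) ^ q)⁻¹)) :=
    have (j : {j // j ∈ J₁ q f}) :
        Module.Finite F (M₂ F (α j + (α j)⁻¹) × M₂ F ((α j) ^ q + ((α j) ^ q)⁻¹)) :=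
      have := f1 j
      have := f2 j
      Module.Finite.prod
    Module.Finite.pi
  have p2 : Module.Finite F ((j : {j // j ∈ J₂ q f ∨ j ∈ J₃ q f}) → M₂ F (α j)) :=
    Module.Finite.pi
  have p3 : Module.Finite F ((j : {j // j ∈ J₄ q f}) → M₂ F (α j) × M₂ F ((α j) ^ q)) :=
    have (j : {j // j ∈ J₄ q f}) : Module.Finite F (M₂ F (α j) × M₂ F ((α j) ^ q)) :=
      have := f0 j
      have := f3 j
      Module.Finite.prod
    Module.Finite.pi
  have p4 := Module.Finite.prod (R := F) (hM := p2) (hN := p3)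
  refine ⟨Module.Finite.prod (hM := p1) (hN := p4), ?_⟩
  rw [Module.finrank_prod, Module.finrank_prod, Module.finrank_pi_fintype,
    Module.finrank_pi_fintype, Module.finrank_pi_fintype]
  simp only [Module.finrank_prod, finrank_M₂]
  refine add_le_add ?_ (add_le_add ?_ ?_)
  · rw [← Finset.sum_coe_sort (J₁ q f) fun j => 4 * d j]
    refine Finset.sum_le_sum fun j _ => ?_
    have := h₁ j j.2
    omega
  · rw [← Finset.sum_union (disjoint_J₂_J₃ q f)]
    simp only [hd]
    exact (Finset.sum_subtype (J₂ q f ∪ J₃ q f) (fun _ => Finset.mem_union) fun j => 4 * d j).ge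
  · rw [← Finset.sum_coe_sort (J₄ q f) fun j => 8 * d j]
    refine Finset.sum_le_sum fun j _ => ?_
    have := finrank_adjoin_le_of_mem (hpow j)
    rw [hd] at this ⊢
    omega

/-- The decomposition of the dihedral group algebra, for any admissible choice of the blocks at
the factors that are fixed by both conjugation and reciprocation. -/
theorem exists_algEquiv_blocks [Finite F] (hq : IsPrimePow q) (hF : Nat.card F = q ^ 2)
    (hqn : Nat.Coprime q n) (hf : IsRefinedFactorisation q n f)
    (hα : ∀ j, aeval (α j) (f j) = 0) {S : Type*} [Ring S] [Algebra F S] [Module.Finite F S]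
    (hS : Module.finrank F S ≤ 2) (A₀ B₀ : {j // j ∈ J₀ q f} → S)
    (hrel : ∀ j, DihedralRelations n (A₀ j) (B₀ j))
    (hdvd : ∀ j p r, evalPair p r (A₀ j) (B₀ j) = 0 → f j ∣ p ∧ f j ∣ r) :
    ∃ ρ : MonoidAlgebra F (DihedralGroup n) ≃ₐ[F] ({j // j ∈ J₀ q f} → S) × MatrixBlocks q f α,
      (∀ j, (ρ (genA F n)).1 j = A₀ j ∧ (ρ (genB F n)).1 j = B₀ j) ∧
      IsGeneratorImage q f α (ρ (genA F n)).2 (ρ (genB F n)).2 := by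
  obtain ⟨⟨φ, hφ⟩, ψ, hψ⟩ := exists_frobenius (L := L) hq hF
  have hnF : (n : F) ≠ 0 := natCast_ne_zero_of_coprime hF hqn
  have hn0 : n ≠ 0 := by
    rintro rfl
    simp at hnF
  have : NeZero n := ⟨hn0⟩
  have hirr := hf.irreducible
  have hm := hf.monic
  have hα0 := hf.ne_zero hα hn0
  have hc0 (j) := coeff_zero_ne_zero (hirr j) (hα0 j) (hα j)
  have hirrc (j) := irreducible_conj φ hφ (hirr j)
  have hmc (j) := monic_conj (φ : F →+* F) hφ (hm j)
  have hαq (j) : aeval (α j ^ q) (conj q (f j)) = 0 := by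
    rw [aeval_conj (φ : F →+* F) hφ ψ hψ, hα, zero_pow hq.ne_zero]
  have hαr (j) := aeval_inv_recip (hα0 j) (hα j)
  have hirrr (j) := irreducible_recip (hirr j) (hm j) (hα0 j) (hα j)
  have hinv (j) (hj : j ∈ J₁ q f) : (α j)⁻¹ ≠ α j :=
    inv_ne_self_of_ne_conj (φ : F →+* F) hφ (hirr j) (hm j) (hα0 j) (hα j) (mem_J₁.1 hj).2
  have hinvq (j) (hj : j ∈ J₁ q f) : (α j ^ q)⁻¹ ≠ α j ^ q := by
    rw [← hψ, ← map_inv₀]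
    exact fun h => hinv j hj (ψ.injective h)
  have h1 (j) (hj : j ∈ J₁ q f) := And.intro (hinv j hj) (hinvq j hj)
  obtain ⟨A, B, hAB⟩ := exists_isGeneratorImage (F := F) hα0 h1
  have hfd (j) := finiteDimensional_adjoin (hm j) (hα j)
  obtain ⟨hfin, hle⟩ := finrank_matrixBlocks_le (q := q) (f := f) (α := α)
    (fun j => (f j).natDegree) (fun j => finrank_adjoin_of_irreducible (hirr j) (hm j) (hα j))
    (fun j hj => by
      have hr : aeval (α j)⁻¹ (f j) = 0 := by
        rw [(mem_J₁.1 hj).1]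
        exact hαr j
      refine ⟨two_mul_finrank_adjoin_add_inv_le (hirr j) (hm j) (hα j) hr (hinv j hj), ?_⟩
      -- The second component is handled by the same bound, applied to the conjugate polynomial and
      -- its root `α j ^ q`.
      rw [← natDegree_conj (φ : F →+* F) hφ]
      refine two_mul_finrank_adjoin_add_inv_le (hirrc j) (hmc j) (hαq j) ?_ (hinvq j hj)
      rw [← inv_pow, aeval_conj (φ : F →+* F) hφ ψ hψ, hr, zero_pow hq.ne_zero])
  have hrelAB : DihedralRelations n (A₀, A) (B₀, B) :=
    .prod (.pi hrel) (hAB.dihedralRelations hα0 h1 (hf.pow_eq_one hα))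
  have hdim : Module.finrank F (({j // j ∈ J₀ q f} → S) × MatrixBlocks q f α) ≤ 2 * n := by
    have h0 : Module.finrank F ({j // j ∈ J₀ q f} → S) ≤ ∑ j ∈ J₀ q f, 2 * (f j).natDegree := by
      rw [Module.finrank_pi_fintype, ← Finset.sum_coe_sort (J₀ q f) fun j => 2 * (f j).natDegree]
      -- An irreducible polynomial has degree at least one, so `2` is at most twice the degree.
      refine Finset.sum_le_sum fun j _ => hS.trans ?_
      have := (hirr j).natDegree_pos
      omega
    have : Module.Free F (MatrixBlocks q f α) := Module.Free.of_divisionRing F _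
    rw [Module.finrank_prod]
    refine (add_le_add h0 hle).trans (le_of_eq ?_)
    conv_rhs => rw [hf.sum_natDegree (φ : F →+* F) hφ hc0]
    simp only [mul_add, Finset.mul_sum, ← mul_assoc]
    norm_num
    ring
  have hfactors {p : F[X]} (h₀ : ∀ j ∈ J₀ q f, f j ∣ p)
      (h₁ : ∀ j ∈ J₁ q f, aeval (α j) p = 0 ∧ aeval (α j ^ q) p = 0)
      (h₂₃ : ∀ j, j ∈ J₂ q f ∨ j ∈ J₃ q f → aeval (α j) p = 0 ∧ aeval (α j)⁻¹ p = 0)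
      (h₄ : ∀ j ∈ J₄ q f, (aeval (α j) p = 0 ∧ aeval (α j)⁻¹ p = 0) ∧
        aeval (α j ^ q) p = 0 ∧ aeval (α j ^ q)⁻¹ p = 0) : X ^ n - 1 ∣ p := by
    have d1 (j) (h : aeval (α j) p = 0) := dvd_of_aeval_eq_zero (hirr j) (hm j) (hα j) h
    have d2 (j) (h : aeval (α j ^ q) p = 0) :=
      dvd_of_aeval_eq_zero (hirrc j) (hmc j) (hαq j) h
    have d3 (j) (h : aeval (α j)⁻¹ p = 0) :=
      dvd_of_aeval_eq_zero (hirrr j) (monic_recip (hc0 j)) (hαr j) h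
    have d4 (j) (h : aeval (α j ^ q)⁻¹ p = 0) : dagger q (f j) ∣ p := by
      refine dvd_of_aeval_eq_zero (irreducible_conj φ hφ (hirrr j))
        (monic_conj (φ : F →+* F) hφ (monic_recip (hc0 j))) ?_ h
      rw [dagger, ← inv_pow, aeval_conj (φ : F →+* F) hφ ψ hψ, hαr, zero_pow hq.ne_zero]
    exact hf.dvd_of_forall hnF h₀ (fun j hj => ⟨d1 j (h₁ j hj).1, d2 j (h₁ j hj).2⟩)
      (fun j hj => ⟨d1 j (h₂₃ j hj).1, d3 j (h₂₃ j hj).2⟩)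
      (fun j hj => ⟨⟨d1 j (h₄ j hj).1.1, d3 j (h₄ j hj).1.2⟩,
        d2 j (h₄ j hj).2.1, d4 j (h₄ j hj).2.2⟩)
  have key {p r : F[X]} (h : evalPair p r ((A₀, A) : _ × MatrixBlocks q f α) (B₀, B) = 0) :
      X ^ n - 1 ∣ p ∧ X ^ n - 1 ∣ r := by
    have hfst := congrArg Prod.fst h
    have hsnd := congrArg Prod.snd h
    rw [evalPair_fst] at hfst
    rw [evalPair_snd] at hsnd
    have hv₀ (j) (hj : j ∈ J₀ q f) : f j ∣ p ∧ f j ∣ r :=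
      hdvd ⟨j, hj⟩ p r ((evalPair_apply p r A₀ B₀ _).symm.trans (congrFun hfst ⟨j, hj⟩))
    obtain ⟨hv₁, hv₂, hv₄⟩ := hAB.vanishAt h1 hsnd
    exact ⟨hfactors (fun j hj => (hv₀ j hj).1)
        (fun j hj => ⟨(hv₁ j hj).1.1.1, (hv₁ j hj).2.1.1⟩) (fun j hj => (hv₂ j hj).1)
        (fun j hj => ⟨(hv₄ j hj).1.1, (hv₄ j hj).2.1⟩),
      hfactors (fun j hj => (hv₀ j hj).2)
        (fun j hj => ⟨(hv₁ j hj).1.2.1, (hv₁ j hj).2.2.1⟩) (fun j hj => (hv₂ j hj).2)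
        (fun j hj => ⟨(hv₄ j hj).1.2, (hv₄ j hj).2.2⟩)⟩
  obtain ⟨ρ, hρA, hρB⟩ := exists_algEquiv_of_relations hrelAB hdim fun p r => key
  refine ⟨ρ, ?_, ?_⟩
  · rw [hρA, hρB]
    exact fun j => ⟨rfl, rfl⟩
  · rw [hρA, hρB]
    exact hAB

/-- The factors fixed by both conjugation and reciprocation are `X - 1` and `X + 1`. -/
theorem eq_of_mem_J₀ [Finite F] (hq : IsPrimePow q) (hF : Nat.card F = q ^ 2)
    (hf : IsRefinedFactorisation q n f) (hn : n ≠ 0) (hα : ∀ j, aeval (α j) (f j) = 0)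
    {j : J} (hj : j ∈ J₀ q f) : f j = X - 1 ∨ f j = X + 1 := by
  obtain ⟨⟨φ, hφ⟩, ψ, hψ⟩ := exists_frobenius (L := L) hq hF
  obtain ⟨hc, hr⟩ := mem_J₀.1 hj
  exact eq_X_sub_one_or_eq_X_add_one (hf.irreducible j) (hf.monic j) (hf.ne_zero hα hn j) (hα j)
    (inv_eq_self_of_conj_eq_of_recip_eq hF (φ : F →+* F) hφ ψ hψ hq.ne_zero (hf.irreducible j)
      (hf.monic j) (hf.ne_zero hα hn j) (hα j) hc hr)

theorem aeval_algebraMap_pair {c : F} (p : F[X]) :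
    aeval ((c, c) : F × F) p = (p.eval c, p.eval c) :=
  (aeval_algebraMap_apply (F × F) c p).trans (by simp [Prod.algebraMap_apply])

/-- The components are `p(c) + r(c)` and `p(c) - r(c)`; recovering both values requires dividing by
`2`. -/
theorem dvd_of_evalPair_pair_eq_zero (h2 : (2 : F) ≠ 0) {c : F} {p r : F[X]}
    (h : evalPair p r ((c, c) : F × F) (1, -1) = 0) : X - C c ∣ p ∧ X - C c ∣ r := by
  simp only [evalPair, aeval_algebraMap_pair, Prod.mk_mul_mk, Prod.mk_add_mk, one_mul,
    Prod.mk_eq_zero] at h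
  obtain ⟨ha, hb⟩ := h
  rw [dvd_iff_isRoot, dvd_iff_isRoot, IsRoot, IsRoot]
  have hp : 2 * p.eval c = 0 := by linear_combination ha + hb
  have hr : 2 * r.eval c = 0 := by linear_combination ha - hb
  exact ⟨(mul_eq_zero.1 hp).resolve_left h2, (mul_eq_zero.1 hr).resolve_left h2⟩

theorem dihedralRelations_pair {c : F} (hc : c * c = 1) (hn : c ^ n = 1) :
    DihedralRelations n ((c, c) : F × F) (1, -1) where
  pow_eq := by simp [hn]
  mul_self := by simp
  mul_mul := by simp [hc]

variable (F) in
theorem C₂gen_mul_self : C₂gen F * C₂gen F = 1 :=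
  Subtype.ext (Units.ext (swapGL F).val_inv)

variable (F) in
theorem C₂gen_ne_one : C₂gen F ≠ 1 := by
  intro h
  have := congrFun (congrFun (congrArg (fun x => x.1.1) h) 0) 0
  simp [C₂gen, swapGL] at this

variable (F) in
theorem natCard_C₂ : Nat.card (C₂ F) = 2 := by
  rw [Nat.card_zpowers, orderOf_eq_prime_iff]
  refine ⟨?_, fun h => C₂gen_ne_one F (Subtype.ext h)⟩
  rw [sq]
  exact congrArg Subtype.val (C₂gen_mul_self F)

theorem dihedralRelations_C₂ :
    DihedralRelations n (MonoidAlgebra.of F (C₂ F) 1) (MonoidAlgebra.of F (C₂ F) (C₂gen F)) where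
  pow_eq := by rw [map_one, one_pow]
  mul_self := by rw [← map_mul, C₂gen_mul_self, map_one]
  mul_mul := by simp

/-- The element is `p(1) + r(1) g` for the generator `g`, and `1`, `g` are distinct basis vectors.
This replaces the argument with signs, which fails when `1 = -1`. -/
theorem dvd_of_evalPair_C₂_eq_zero {p r : F[X]}
    (h : evalPair p r (MonoidAlgebra.of F (C₂ F) 1) (MonoidAlgebra.of F (C₂ F) (C₂gen F)) = 0) :
    X - 1 ∣ p ∧ X - 1 ∣ r := by
  have haeval (s : F[X]) : aeval (1 : MonoidAlgebra F (C₂ F)) s = MonoidAlgebra.single 1 (s.eval 1) := by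
    have := aeval_algebraMap_apply (MonoidAlgebra F (C₂ F)) (1 : F) s
    rwa [map_one] at this
  rw [evalPair, map_one, haeval, haeval, MonoidAlgebra.of_apply, MonoidAlgebra.single_mul_single,
    mul_one, one_mul] at h
  have hp := congrArg (fun x => x.coeff 1) h
  have hr := congrArg (fun x => x.coeff (C₂gen F)) h
  simp [C₂gen_ne_one F, (C₂gen_ne_one F).symm] at hp hr
  rw [← C_1, dvd_iff_isRoot, dvd_iff_isRoot]
  exact ⟨hp, hr⟩

end Assembly

end HermitianDihedral

/-! ### The decomposition theorem in odd and even characteristic -/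

open HermitianDihedral in
theorem theorem3p3 {F : Type*} [Field F] [Finite F] {L : Type*} [Field L] [Algebra F L]
    (q n : ℕ) (hq : IsPrimePow q) (hF : Nat.card F = q ^ 2) (hqn : Nat.Coprime q n)
    {J : Type*} [Fintype J] (f : J → F[X]) (hf : IsRefinedFactorisation q n f)
    (α : J → L) (hα : ∀ j, aeval (α j) (f j) = 0) :
    (ringChar F ≠ 2 →
      ∃ ρ : MonoidAlgebra F (DihedralGroup n) ≃ₐ[F]
          ((j : {j // j ∈ J₀ q f}) → F × F) × MatrixBlocks q f α,
        (∀ j : {j // j ∈ J₀ q f},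
          (f j = X - 1 ∧ (ρ (genA F n)).1 j = (1, 1) ∧ (ρ (genB F n)).1 j = (1, -1)) ∨
          (f j = X + 1 ∧ (ρ (genA F n)).1 j = (-1, -1) ∧ (ρ (genB F n)).1 j = (1, -1))) ∧
        IsGeneratorImage q f α (ρ (genA F n)).2 (ρ (genB F n)).2) ∧
    (ringChar F = 2 →
      ∃ ρ : MonoidAlgebra F (DihedralGroup n) ≃ₐ[F]
          ((j : {j // j ∈ J₀ q f}) → MonoidAlgebra F (C₂ F)) × MatrixBlocks q f α,
        (∀ j : {j // j ∈ J₀ q f},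
          (ρ (genA F n)).1 j = MonoidAlgebra.of F (C₂ F) 1 ∧
          (ρ (genB F n)).1 j = MonoidAlgebra.of F (C₂ F) (C₂gen F)) ∧
        IsGeneratorImage q f α (ρ (genA F n)).2 (ρ (genB F n)).2) := by
  have hn0 : n ≠ 0 := by
    rintro rfl
    rw [Nat.coprime_zero_right] at hqn
    exact hq.ne_one hqn
  have hJ₀ (j : {j // j ∈ J₀ q f}) : f j = X - 1 ∨ f j = X + 1 := eq_of_mem_J₀ hq hF hf hn0 hα j.2
  refine ⟨fun hchar => ?_, fun hchar => ?_⟩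
  · have h2 : (2 : F) ≠ 0 := Ring.two_ne_zero hchar
    have hc (j : {j // j ∈ J₀ q f}) : ∃ c : F, f j = X - C c ∧ c * c = 1 ∧ c ^ n = 1 ∧
        ((f j = X - 1 ∧ c = 1) ∨ (f j = X + 1 ∧ c = -1)) := by
      have hpow {c : F} (h : f j = X - C c) : c ^ n = 1 := by
        have := dvd_iff_isRoot.1 (h ▸ hf.dvd j)
        simpa [sub_eq_zero] using this
      rcases hJ₀ j with h | h
      · have h' : f j = X - C 1 := by rw [h, C_1]
        exact ⟨1, h', one_mul 1, hpow h', .inl ⟨h, rfl⟩⟩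
      · have h' : f j = X - C (-1) := by rw [h, C_neg, C_1, sub_neg_eq_add]
        exact ⟨-1, h', by ring, hpow h', .inr ⟨h, rfl⟩⟩
    choose c hfc hcc hcn hcases using hc
    obtain ⟨ρ, hρ₀, hρ⟩ := exists_algEquiv_blocks hq hF hqn hf hα (S := F × F) (by simp)
      (fun j => (c j, c j)) (fun _ => (1, -1)) (fun j => dihedralRelations_pair (hcc j) (hcn j))
      (fun j p r h => by
        rw [hfc]
        exact dvd_of_evalPair_pair_eq_zero h2 h)
    refine ⟨ρ, fun j => ?_, hρ⟩
    rcases hcases j with ⟨h, h'⟩ | ⟨h, h'⟩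
    · exact .inl ⟨h, by rw [(hρ₀ j).1, h'], (hρ₀ j).2⟩
    · exact .inr ⟨h, by rw [(hρ₀ j).1, h'], (hρ₀ j).2⟩
  · have : CharP F 2 := ringChar.of_eq hchar
    have hfin : Module.finrank F (MonoidAlgebra F (C₂ F)) = 2 := by
      rw [finrank_monoidAlgebra, natCard_C₂]
    have : Module.Finite F (MonoidAlgebra F (C₂ F)) :=
      Module.finite_of_finrank_pos (by rw [hfin]; norm_num)
    obtain ⟨ρ, hρ₀, hρ⟩ := exists_algEquiv_blocks hq hF hqn hf hα hfin.le
      (fun _ => MonoidAlgebra.of F (C₂ F) 1) (fun _ => MonoidAlgebra.of F (C₂ F) (C₂gen F))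
      (fun _ => dihedralRelations_C₂) (fun j p r h => by
        -- In characteristic two the alternatives `X - 1` and `X + 1` coincide.
        have hj : f j = X - 1 := by
          rcases hJ₀ j with h | h
          · exact h
          · rw [h, CharTwo.sub_eq_add]
        rw [hj]
        exact dvd_of_evalPair_C₂_eq_zero h)
    exact ⟨ρ, hρ₀, hρ⟩
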